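/- Let $\mathcal H$ be a complex Hilbert space of arbitrary (finite or infinite) dimension, let $\rho_1,\rho_2$ be two density operators on $\mathcal H$ (pure or mixed), and let $q_1,q_2>0$, $q_1+q_2=1$, be their prior probabilities. A *state instrument* with outcomes $\{1,2\}$ is a family $\mathcal M=\{\mathcal M(1),\mathcal M(2)\}$ of completely positive, trace-norm bounded linear maps on the trace class operators of $\mathcal H$ such that $\operatorname{tr}\mathcal M(1)[T]+\operatorname{tr}\mathcal M(2)[T]=\operatorname{tr}T$ for all trace class $T$. A *protocol* with $N$ sequential receivers is a sequence $\mathcal M_1,\dots,\mathcal M_N$ of such instruments, the $n$-th receiver applying $\mathcal M_n$ to the state left by the receivers before; its success probability is $$\sum_{j=1,2}q_j\operatorname{tr}\bigl\{\mathcal M_N(j)\bigl[\cdots\mathcal M_1(j)[\rho_j]\cdots\bigr]\bigr\},$$ and the *optimal success probability* is the maximum of this quantity over all protocols with $N$ receivers. Let $\mathrm P_0(1)$ be the orthogonal projection onto the closed linear span of the eigenvectors of $q_1\rho_1-q_2\rho_2$ with positive eigenvalues, and $\mathrm P_0(2)=\mathbb I-\mathrm P_0(1)$. Then, for every $N\ge1$: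 1. The maximum exists, and the optimal success probability is equal to the Helstrom bound $\frac12\bigl(1+\|q_1\rho_1-q_2\rho_2\|_1\bigr)$, where $\|\cdot\|_1$ is the trace norm. 2. It is attained by the protocol in which every receiver applies the instrument $\mathcal M_n(j)[T]=\mathrm P_0(j)\,T\,\mathrm P_0(j)$, $j=1,2$. 3. Suppose that $\mathrm P_0(1)\ne0$ and $\mathrm P_0(2)\ne0$. Let $\{v_i(j)\}_{i}$, $j=1,2$, be any orthonormal bases of the ranges of $\mathrm P_0(1)$ and $\mathrm P_0(2)$, that is, $\langle v_i(j)|v_{i'}(j')\rangle=\delta_{ii'}\delta_{jj'}$ and $\sum_i|v_i(j)\rangle\langle v_i(j)|=\mathrm P_0(j)$, and let $\{\varphi_i(j)\}_{i,\,j=1,2}$ be any orthonormal basis of $\mathcal H$ indexed by the same pairs $(i,j)$. Put $$\widetilde{\mathrm K}(j)=\sum_i|\varphi_i(j)\rangle\langle v_i(j)|,\qquad \widetilde{\mathrm P}(j)=\sum_i|\varphi_i(j)\rangle\langle\varphi_i(j)|,\qquad j=1,2$$ (the sums converge strongly). Then the optimal success probability is also attained by the protocol in which the first receiver applies the instrument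 $T\mapsto\widetilde{\mathrm K}(j)\,T\,\widetilde{\mathrm K}(j)^\dagger$ and every later receiver applies $T\mapsto\widetilde{\mathrm P}(j)\,T\,\widetilde{\mathrm P}(j)$, $j=1,2$. -/

import Mathlib

open scoped InnerProductSpace ENNReal ComplexOrder

noncomputable section

namespace SeqDisc

universe u

section TraceClassOperators

variable (H : Type u) [NormedAddCommGroup H] [InnerProductSpace ℂ H] [CompleteSpace H]

/-- The index set of a fixed orthonormal (Hilbert) basis of `H`. -/
def basisIndex : Set H := (exists_hilbertBasis ℂ H).choose

/-- A fixed orthonormal (Hilbert) basis of `H`, used to write down traces. -/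
def onb : HilbertBasis (basisIndex H) ℂ H := (exists_hilbertBasis ℂ H).choose_spec.choose

variable {H}

/-- The trace norm `‖T‖₁ = tr |T| = ∑ᵢ ⟪eᵢ, |T| eᵢ⟫ ∈ [0, ∞]`, where `|T| = (T† T)^{1/2}`. -/
def traceNorm (T : H →L[ℂ] H) : ℝ≥0∞ :=
  ∑' i, ENNReal.ofReal (⟪onb H i, CFC.abs T (onb H i)⟫_ℂ).re

/-- The trace `tr T = ∑ᵢ ⟪eᵢ, T eᵢ⟫`. -/
def opTrace (T : H →L[ℂ] H) : ℂ := ∑' i, ⟪onb H i, T (onb H i)⟫_ℂ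

/-! The trace class operators form a linear subspace. -/

/-- The squared Hilbert-Schmidt norm. -/
def hsSq (T : H →L[ℂ] H) : ℝ≥0∞ := ∑' i, ENNReal.ofReal (‖T (onb H i)‖ ^ 2)

lemma ofReal_norm_sq_eq_tsum (x : H) :
    ENNReal.ofReal (‖x‖ ^ 2) = ∑' j, ENNReal.ofReal (‖⟪onb H j, x⟫_ℂ‖ ^ 2) := by
  have h := (onb H).hasSum_inner_mul_inner x x
  have h2 : HasSum (fun j => ‖⟪onb H j, x⟫_ℂ‖ ^ 2) (‖x‖ ^ 2) := by
    have h3 := Complex.hasSum_re h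
    rw [inner_self_eq_norm_sq_to_K] at h3
    convert h3 using 1
    · funext j
      rw [← inner_conj_symm x, Complex.conj_mul']
      norm_cast
    · norm_cast
  rw [← h2.tsum_eq, ENNReal.ofReal_tsum_of_nonneg (fun _ => by positivity) h2.summable]

lemma hsSq_star (T : H →L[ℂ] H) : hsSq (star T) = hsSq T := by
  unfold hsSq
  rw [tsum_congr fun i => ofReal_norm_sq_eq_tsum (star T (onb H i)),
    tsum_congr fun i => ofReal_norm_sq_eq_tsum (T (onb H i)), ENNReal.tsum_comm]
  congr 1; funext i; congr 1; funext j
  rw [ContinuousLinearMap.star_eq_adjoint, ContinuousLinearMap.adjoint_inner_right,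
    ← inner_conj_symm, RCLike.norm_conj]

lemma hsSq_mul_le_left (U T : H →L[ℂ] H) (hU : ‖U‖ ≤ 1) : hsSq (U * T) ≤ hsSq T := by
  refine ENNReal.tsum_le_tsum fun i => ENNReal.ofReal_le_ofReal ?_
  gcongr
  exact (U.le_of_opNorm_le hU _).trans (by simp)

lemma hsSq_mul_le_right (T U : H →L[ℂ] H) (hU : ‖U‖ ≤ 1) : hsSq (T * U) ≤ hsSq T := by
  rw [← hsSq_star, star_mul, ← hsSq_star T]
  exact hsSq_mul_le_left _ _ (by rwa [norm_star])

/-- The positive square root of `|T|`. -/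
def absSqrt (T : H →L[ℂ] H) : H →L[ℂ] H := CFC.sqrt (CFC.abs T)

lemma absSqrt_star (T : H →L[ℂ] H) : star (absSqrt T) = absSqrt T :=
  (IsSelfAdjoint.of_nonneg (CFC.sqrt_nonneg _)).star_eq

lemma absSqrt_mul_self (T : H →L[ℂ] H) : absSqrt T * absSqrt T = CFC.abs T :=
  CFC.sqrt_mul_sqrt_self _ (CFC.abs_nonneg T)

lemma inner_abs (T : H →L[ℂ] H) (x y : H) :
    ⟪x, CFC.abs T y⟫_ℂ = ⟪absSqrt T x, absSqrt T y⟫_ℂ := by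
  rw [← absSqrt_mul_self, mul_apply_eq_comp, ← ContinuousLinearMap.adjoint_inner_left,
    ← ContinuousLinearMap.star_eq_adjoint, absSqrt_star]

lemma re_inner_abs (T : H →L[ℂ] H) (x : H) : (⟪x, CFC.abs T x⟫_ℂ).re = ‖absSqrt T x‖ ^ 2 := by
  rw [inner_abs, inner_self_eq_norm_sq_to_K]; norm_cast

lemma traceNorm_eq_hsSq (T : H →L[ℂ] H) : traceNorm T = hsSq (absSqrt T) := by
  unfold traceNorm hsSq
  simp_rw [re_inner_abs]

/-- An approximate polar decomposition. -/
lemma exists_approx_polar (T : H →L[ℂ] H) {ε : ℝ} (hε : 0 < ε) :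
    ∃ U : H →L[ℂ] H, ‖U‖ ≤ 1 ∧ ‖T - U * CFC.abs T‖ ≤ ε ∧ ‖CFC.abs T - star U * T‖ ≤ ε := by
  set A := CFC.abs T with hA
  have hA0 : 0 ≤ A := CFC.abs_nonneg T
  have hsa : IsSelfAdjoint A := IsSelfAdjoint.of_nonneg hA0
  have hsp : ∀ x ∈ spectrum ℝ A, 0 ≤ x := fun x hx => spectrum_nonneg_of_nonneg hA0 hx
  have hc : ContinuousOn (fun x : ℝ => (x + ε)⁻¹) (spectrum ℝ A) :=
    ContinuousOn.inv₀ (by fun_prop) fun x hx => by have := hsp x hx; positivity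
  set R := cfc (fun x : ℝ => (x + ε)⁻¹) A with hR
  have hRsa : star R = R := (cfc_predicate (fun x : ℝ => (x + ε)⁻¹) A : IsSelfAdjoint _).star_eq
  have hAA : A * A = star T * T := CFC.abs_mul_abs T
  have hid : cfc (fun x : ℝ => x) A = A := cfc_id' ℝ A
  have hRA : R * A = cfc (fun x : ℝ => (x + ε)⁻¹ * x) A := by
    conv_lhs => rw [← hid, hR]
    rw [← cfc_mul _ _ A hc (by fun_prop)]
  have hc2 : ContinuousOn (fun x : ℝ => (x + ε)⁻¹ * x) (spectrum ℝ A) := hc.mul (by fun_prop)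
  have hAR : A * R = R * A := by
    conv_lhs => rw [← hid, hR]
    rw [← cfc_mul _ _ A (by fun_prop) hc, hRA]
    simp_rw [mul_comm]
  have hRAle : ‖R * A‖ ≤ 1 := by
    rw [hRA]
    refine norm_cfc_le zero_le_one fun x hx => ?_
    have := hsp x hx
    rw [Real.norm_of_nonneg (by positivity), inv_mul_le_iff₀ (by positivity)]
    linarith
  have hone : (1 : H →L[ℂ] H) - R * A = ε • R := by
    rw [hRA, hR, ← cfc_smul ε _ A hc, ← cfc_one ℝ A,
      ← cfc_sub _ _ A (by fun_prop) hc2]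
    refine cfc_congr fun x hx => ?_
    have := hsp x hx
    simp only [Pi.one_apply, smul_eq_mul]
    field_simp
    ring
  have hU : ‖T * R‖ ≤ 1 := by
    have h1 : ‖T * R‖ * ‖T * R‖ = ‖(R * A) * (R * A)‖ := by
      rw [← CStarRing.norm_star_mul_self, star_mul, hRsa, mul_assoc, ← mul_assoc (star T),
        ← hAA, mul_assoc A, hAR, mul_assoc R, ← mul_assoc A, hAR, mul_assoc R A]
    have h2 : ‖(R * A) * (R * A)‖ ≤ 1 :=
      (norm_mul_le _ _).trans (mul_le_one₀ hRAle (norm_nonneg _) hRAle)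
    nlinarith [norm_nonneg (T * R)]
  refine ⟨T * R, hU, ?_, ?_⟩
  · have : T - T * R * A = ε • (T * R) := by
      rw [mul_assoc, ← mul_one_sub, hone, mul_smul_comm]
    rw [this, norm_smul, Real.norm_of_nonneg hε.le]
    nlinarith
  · have : A - star (T * R) * T = ε • (R * A) := by
      rw [star_mul, hRsa, mul_assoc, ← hAA, ← mul_assoc, ← one_sub_mul, hone, smul_mul_assoc]
    rw [this, norm_smul, Real.norm_of_nonneg hε.le]
    nlinarith

lemma sum_norm_inner_le (A U : H →L[ℂ] H) (hU : ‖U‖ ≤ 1) (F : Finset (basisIndex H)) :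
    ∑ i ∈ F, ENNReal.ofReal ‖⟪U (onb H i), A (onb H i)⟫_ℂ‖ ≤ traceNorm A := by
  refine ENNReal.le_of_forall_pos_le_add fun η hη hfin => ?_
  set δ : ℝ := η / (F.card + 1) with hδ
  have hδ0 : 0 < δ := by positivity
  obtain ⟨V, hV, hV2, -⟩ := exists_approx_polar A hδ0
  set S := absSqrt A with hS
  have hSV : ‖star V * U‖ ≤ 1 :=
    (norm_mul_le _ _).trans (mul_le_one₀ (by rwa [norm_star]) (norm_nonneg _) hU)
  have key : ∀ i, ‖⟪U (onb H i), A (onb H i)⟫_ℂ‖ ≤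
      (1 / 2) * ‖(S * (star V * U)) (onb H i)‖ ^ 2 + (1 / 2) * ‖S (onb H i)‖ ^ 2 + δ := by
    intro i
    set e := onb H i
    have he : ‖e‖ = 1 := (onb H).orthonormal.1 i
    have h1 : ⟪U e, A e⟫_ℂ = ⟪(S * (star V * U)) e, S e⟫_ℂ + ⟪U e, (A - V * CFC.abs A) e⟫_ℂ := by
      have : ⟪(S * (star V * U)) e, S e⟫_ℂ = ⟪U e, (V * CFC.abs A) e⟫_ℂ := by
        simp only [mul_apply_eq_comp]
        rw [← inner_abs, ContinuousLinearMap.star_eq_adjoint,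
          ContinuousLinearMap.adjoint_inner_left]
      rw [this, ← inner_add_right]
      simp
    have h2 : ‖⟪U e, (A - V * CFC.abs A) e⟫_ℂ‖ ≤ δ := by
      refine (norm_inner_le_norm _ _).trans ?_
      have a1 := (U.le_of_opNorm_le hU e)
      have a2 := ((A - V * CFC.abs A).le_of_opNorm_le hV2 e)
      rw [he] at a1 a2
      nlinarith [norm_nonneg (U e), norm_nonneg ((A - V * CFC.abs A) e)]
    have h3 := norm_inner_le_norm (𝕜 := ℂ) ((S * (star V * U)) e) (S e)
    rw [h1]
    refine (norm_add_le _ _).trans ?_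
    nlinarith [sq_nonneg (‖(S * (star V * U)) e‖ - ‖S e‖)]
  have half : ENNReal.ofReal (1 / 2) * traceNorm A + ENNReal.ofReal (1 / 2) * traceNorm A
      = traceNorm A := by
    rw [← add_mul, ← ENNReal.ofReal_add (by norm_num) (by norm_num)]; norm_num
  calc ∑ i ∈ F, ENNReal.ofReal ‖⟪U (onb H i), A (onb H i)⟫_ℂ‖
      ≤ ∑ i ∈ F, (ENNReal.ofReal (1 / 2) * ENNReal.ofReal (‖(S * (star V * U)) (onb H i)‖ ^ 2)
          + ENNReal.ofReal (1 / 2) * ENNReal.ofReal (‖S (onb H i)‖ ^ 2) + ENNReal.ofReal δ) := by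
        refine Finset.sum_le_sum fun i _ => (ENNReal.ofReal_le_ofReal (key i)).trans ?_
        rw [ENNReal.ofReal_add (by positivity) hδ0.le, ENNReal.ofReal_add (by positivity)
          (by positivity), ENNReal.ofReal_mul (by norm_num), ENNReal.ofReal_mul (by norm_num)]
    _ = ENNReal.ofReal (1 / 2) * ∑ i ∈ F, ENNReal.ofReal (‖(S * (star V * U)) (onb H i)‖ ^ 2)
          + ENNReal.ofReal (1 / 2) * ∑ i ∈ F, ENNReal.ofReal (‖S (onb H i)‖ ^ 2)
          + F.card * ENNReal.ofReal δ := by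
        rw [Finset.sum_add_distrib, Finset.sum_add_distrib, Finset.mul_sum, Finset.mul_sum]
        simp
    _ ≤ ENNReal.ofReal (1 / 2) * traceNorm A + ENNReal.ofReal (1 / 2) * traceNorm A + η := by
        gcongr
        · refine (ENNReal.sum_le_tsum F).trans ?_
          rw [traceNorm_eq_hsSq]
          exact hsSq_mul_le_right S _ hSV
        · refine (ENNReal.sum_le_tsum F).trans ?_
          rw [traceNorm_eq_hsSq]
          exact le_rfl
        · rw [← ENNReal.ofReal_natCast, ← ENNReal.ofReal_mul (by positivity),
            ← ENNReal.ofReal_coe_nnreal]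
          refine ENNReal.ofReal_le_ofReal ?_
          rw [hδ, mul_div_assoc', div_le_iff₀ (by positivity)]
          nlinarith [η.coe_nonneg]
    _ = traceNorm A + η := by rw [half]

lemma traceNorm_add_le (A B : H →L[ℂ] H) : traceNorm (A + B) ≤ traceNorm A + traceNorm B := by
  conv_lhs => rw [traceNorm]
  rw [ENNReal.tsum_eq_iSup_sum]
  refine iSup_le fun F => ENNReal.le_of_forall_pos_le_add fun η hη hfin => ?_
  set δ : ℝ := η / (F.card + 1) with hδ
  have hδ0 : 0 < δ := by positivity
  obtain ⟨U, hU, -, hU2⟩ := exists_approx_polar (A + B) hδ0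
  have key : ∀ i, (⟪onb H i, CFC.abs (A + B) (onb H i)⟫_ℂ).re ≤
      ‖⟪U (onb H i), A (onb H i)⟫_ℂ‖ + ‖⟪U (onb H i), B (onb H i)⟫_ℂ‖ + δ := by
    intro i
    set e := onb H i
    have he : ‖e‖ = 1 := (onb H).orthonormal.1 i
    have h1 : ⟪e, CFC.abs (A + B) e⟫_ℂ = ⟪U e, A e⟫_ℂ + ⟪U e, B e⟫_ℂ
        + ⟪e, (CFC.abs (A + B) - star U * (A + B)) e⟫_ℂ := by
      rw [← inner_add_right, ← add_apply,
        ← ContinuousLinearMap.adjoint_inner_right, ← ContinuousLinearMap.star_eq_adjoint,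
        ← inner_add_right]
      simp
    have h2 : ‖⟪e, (CFC.abs (A + B) - star U * (A + B)) e⟫_ℂ‖ ≤ δ := by
      refine (norm_inner_le_norm _ _).trans ?_
      have a2 := ((CFC.abs (A + B) - star U * (A + B)).le_of_opNorm_le hU2 e)
      rw [he] at a2 ⊢
      linarith
    refine (Complex.re_le_norm _).trans ?_
    rw [h1]
    refine (norm_add_le _ _).trans ?_
    gcongr
    exact norm_add_le _ _
  calc ∑ i ∈ F, ENNReal.ofReal (⟪onb H i, CFC.abs (A + B) (onb H i)⟫_ℂ).re
      ≤ ∑ i ∈ F, (ENNReal.ofReal ‖⟪U (onb H i), A (onb H i)⟫_ℂ‖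
          + ENNReal.ofReal ‖⟪U (onb H i), B (onb H i)⟫_ℂ‖ + ENNReal.ofReal δ) := by
        refine Finset.sum_le_sum fun i _ => (ENNReal.ofReal_le_ofReal (key i)).trans ?_
        rw [ENNReal.ofReal_add (by positivity) hδ0.le, ENNReal.ofReal_add (by positivity)
          (by positivity)]
    _ = ∑ i ∈ F, ENNReal.ofReal ‖⟪U (onb H i), A (onb H i)⟫_ℂ‖
          + ∑ i ∈ F, ENNReal.ofReal ‖⟪U (onb H i), B (onb H i)⟫_ℂ‖
          + F.card * ENNReal.ofReal δ := by
        rw [Finset.sum_add_distrib, Finset.sum_add_distrib]; simp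
    _ ≤ traceNorm A + traceNorm B + η := by
        gcongr
        · exact sum_norm_inner_le A U hU F
        · exact sum_norm_inner_le B U hU F
        · rw [← ENNReal.ofReal_natCast, ← ENNReal.ofReal_mul (by positivity),
            ← ENNReal.ofReal_coe_nnreal]
          refine ENNReal.ofReal_le_ofReal ?_
          rw [hδ, mul_div_assoc', div_le_iff₀ (by positivity)]
          nlinarith [η.coe_nonneg]

lemma traceNorm_zero : traceNorm (0 : H →L[ℂ] H) = 0 := by
  simp [traceNorm]

lemma traceNorm_smul (c : ℂ) (T : H →L[ℂ] H) :
    traceNorm (c • T) = ENNReal.ofReal ‖c‖ * traceNorm T := by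
  unfold traceNorm
  rw [← ENNReal.tsum_mul_left]
  congr 1; funext i
  rw [← ENNReal.ofReal_mul (norm_nonneg c), CFC.abs_smul]
  simp

variable (H) in
/-- The space `𝒯(H)` of trace class operators: bounded operators with `tr |T| < ∞`. -/
def TraceClass : Submodule ℂ (H →L[ℂ] H) where
  carrier := {T | traceNorm T < ∞}
  add_mem' {A B} hA hB := (traceNorm_add_le A B).trans_lt (ENNReal.add_lt_top.2 ⟨hA, hB⟩)
  zero_mem' := by simp [traceNorm_zero]
  smul_mem' c T hT := by
    simp only [Set.mem_ofPred_eq] at hT ⊢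
    rw [traceNorm_smul]
    exact ENNReal.mul_lt_top ENNReal.ofReal_lt_top hT

end TraceClassOperators

section Measurements

variable (H : Type u) [NormedAddCommGroup H] [InnerProductSpace ℂ H] [CompleteSpace H]

/-- A quantum state (density operator): a positive trace class operator of trace one. -/
structure DensityOperator where
  op : TraceClass H
  pos : 0 ≤ (op : H →L[ℂ] H)
  trace_eq_one : opTrace (op : H →L[ℂ] H) = 1

variable {H}

/-- Positivity of an `n × n` block matrix of operators on `H`, as an operator on `Hⁿ`. -/
def BlockPositive {n : ℕ} (T : Fin n → Fin n → TraceClass H) : Prop :=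
  ∀ x : Fin n → H, 0 ≤ ∑ i, ∑ k, ⟪x i, (T i k : H →L[ℂ] H) (x k)⟫_ℂ

/-- Complete positivity of a linear map `𝒯(H) → 𝒯(H)`: for every `n`, its entrywise application
to `n × n` block matrices preserves positivity. -/
def IsCompletelyPositive (Φ : TraceClass H →ₗ[ℂ] TraceClass H) : Prop :=
  ∀ (n : ℕ) (T : Fin n → Fin n → TraceClass H),
    BlockPositive T → BlockPositive fun i k => Φ (T i k)

/-- Boundedness of a linear map `𝒯(H) → 𝒯(H)` in the trace norm. -/
def IsTraceNormBounded (Φ : TraceClass H →ₗ[ℂ] TraceClass H) : Prop :=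
  ∃ C : NNReal, ∀ T : TraceClass H,
    traceNorm (Φ T : H →L[ℂ] H) ≤ C * traceNorm (T : H →L[ℂ] H)

variable (H) in
/-- A state instrument with finitely many outcomes `ω ∈ Ω`: completely positive bounded linear maps
`ℳ(ω) : 𝒯(H) → 𝒯(H)` with `∑_ω tr (ℳ(ω)[T]) = tr T` for all `T ∈ 𝒯(H)`. -/
structure StateInstrument (Ω : Type*) [Fintype Ω] where
  map : Ω → TraceClass H →ₗ[ℂ] TraceClass H
  completelyPositive : ∀ ω, IsCompletelyPositive (map ω)
  bounded : ∀ ω, IsTraceNormBounded (map ω)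
  trace_preserving : ∀ T : TraceClass H,
    ∑ ω, opTrace (map ω T : H →L[ℂ] H) = opTrace (T : H →L[ℂ] H)

/-- The instrument is pure with Kraus operators `K ω`: `ℳ(ω)[T] = K(ω) T K(ω)†`. -/
def StateInstrument.HasKraus {Ω : Type*} [Fintype Ω] (M : StateInstrument H Ω)
    (K : Ω → H →L[ℂ] H) : Prop :=
  ∀ (ω : Ω) (T : TraceClass H), (M.map ω T : H →L[ℂ] H) = K ω * (T : H →L[ℂ] H) * star (K ω)

/-- The values of the consecutive measurement of `N` receivers, the `n`-th one applying the
instrument `M n`: `ℳ(j₁, …, j_N) = ℳ_N(j_N) ∘ ⋯ ∘ ℳ₁(j₁)`. The receivers are numbered from `0`. -/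
def consecutive {Ω : Type*} [Fintype Ω] : (N : ℕ) → (Fin N → StateInstrument H Ω) →
    (Fin N → Ω) → TraceClass H →ₗ[ℂ] TraceClass H
  | 0, _, _ => LinearMap.id
  | N + 1, M, j => (M (Fin.last N)).map (j (Fin.last N)) ∘ₗ
      consecutive N (fun n => M n.castSucc) (fun n => j n.castSucc)

/-- The success probability `∑_j q_j tr (ℳ(j, …, j)[ρ_j])` of the `N`-sequential conclusive
discrimination of `ρ_1, …, ρ_r` with priors `q_1, …, q_r`. -/
def successProb {r N : ℕ} (ρ : Fin r → DensityOperator H) (q : Fin r → ℝ)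
    (M : Fin N → StateInstrument H (Fin r)) : ℝ :=
  ∑ j, q j * (opTrace (consecutive N M (fun _ => j) (ρ j).op : H →L[ℂ] H)).re

/-- `p` is the optimal success probability: the maximum of the success probabilities over all
protocols with `N` receivers. -/
def IsOptimalSuccessProb {r : ℕ} (N : ℕ) (ρ : Fin r → DensityOperator H) (q : Fin r → ℝ)
    (p : ℝ) : Prop :=
  IsGreatest (Set.range fun M : Fin N → StateInstrument H (Fin r) => successProb ρ q M) p

end Measurements

section TwoStates

variable {H : Type u} [NormedAddCommGroup H] [InnerProductSpace ℂ H] [CompleteSpace H]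

/-- The Hermitian trace class operator `q₁ρ₁ - q₂ρ₂`. -/
def helstromOp (ρ : Fin 2 → DensityOperator H) (q : Fin 2 → ℝ) : H →L[ℂ] H :=
  (q 0 : ℂ) • ((ρ 0).op : H →L[ℂ] H) - (q 1 : ℂ) • ((ρ 1).op : H →L[ℂ] H)

/-- The Helstrom bound `(1 + ‖q₁ρ₁ - q₂ρ₂‖₁) / 2`. -/
def helstromBound (ρ : Fin 2 → DensityOperator H) (q : Fin 2 → ℝ) : ℝ :=
  (1 + (traceNorm (helstromOp ρ q)).toReal) / 2

/-- The closed linear span of all eigenspaces of `X` for positive eigenvalues. -/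
def positiveSubspace (X : H →L[ℂ] H) : Submodule ℂ H :=
  (⨆ (t : ℝ) (_ : 0 < t), Module.End.eigenspace (X : H →ₗ[ℂ] H) (t : ℂ)).topologicalClosure

instance (X : H →L[ℂ] H) : CompleteSpace (positiveSubspace X) :=
  inferInstanceAs (CompleteSpace (Submodule.topologicalClosure _))

/-- The Helstrom projections: `P₀(1)` is the orthogonal projection onto the span of the eigenspaces
of `q₁ρ₁ - q₂ρ₂` for positive eigenvalues, and `P₀(2) = 1 - P₀(1)`.
The outcomes `1, 2` are the elements `0, 1` of `Fin 2`. -/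
def helstromProj (ρ : Fin 2 → DensityOperator H) (q : Fin 2 → ℝ) : Fin 2 → H →L[ℂ] H :=
  ![(positiveSubspace (helstromOp ρ q)).starProjection,
    1 - (positiveSubspace (helstromOp ρ q)).starProjection]

/-- The isometry `ℓ²(ι) → H`, `c ↦ ∑ᵢ cᵢ vᵢ`, of an orthonormal family `v`. -/
def synthesis {ι : Type*} {v : ι → H} (hv : Orthonormal ℂ v) :
    lp (fun _ : ι => ℂ) 2 →ₗᵢ[ℂ] H :=
  hv.orthogonalFamily.linearIsometry

/-- The bounded operator `∑ᵢ |φᵢ⟩⟨vᵢ|` for orthonormal families `φ`, `v` of the same, possibly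
infinite, size; the series converges strongly, see `hasSum_ketBra`. -/
def ketBra {ι : Type*} {φ v : ι → H} (hφ : Orthonormal ℂ φ) (hv : Orthonormal ℂ v) : H →L[ℂ] H :=
  (synthesis hφ).toContinuousLinearMap ∘L
    ContinuousLinearMap.adjoint (synthesis hv).toContinuousLinearMap

lemma hasSum_ketBra {ι : Type*} {φ v : ι → H} (hφ : Orthonormal ℂ φ) (hv : Orthonormal ℂ v)
    (x : H) : HasSum (fun i => ⟪v i, x⟫_ℂ • φ i) (ketBra hφ hv x) := by
  classical
  change HasSum _ (hφ.orthogonalFamily.linearIsometry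
    (ContinuousLinearMap.adjoint (synthesis hv).toContinuousLinearMap x))
  have h := hφ.orthogonalFamily.hasSum_linearIsometry
    (ContinuousLinearMap.adjoint (synthesis hv).toContinuousLinearMap x)
  convert h using 1
  funext i
  have h1 : (ContinuousLinearMap.adjoint (synthesis hv).toContinuousLinearMap x) i = 
      ⟪v i, x⟫_ℂ := by
    have h2 := ContinuousLinearMap.adjoint_inner_right (synthesis hv).toContinuousLinearMap
      (lp.single 2 i (1 : ℂ)) x
    rw [lp.inner_single_left] at h2
    simp only [RCLike.inner_apply, map_one, mul_one] at h2
    rw [h2]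
    congr 1
    simp [synthesis, OrthogonalFamily.linearIsometry_apply_single]
  rw [h1]
  simp

/-- For orthonormal families `φ`, `v` indexed by pairs `(j, i)`, the operators
`∑ᵢ |φᵢ(j)⟩⟨vᵢ(j)|`, `j = 1, 2`. -/
def blockKetBra {ι : Fin 2 → Type*} {φ v : (Σ j, ι j) → H} (hφ : Orthonormal ℂ φ)
    (hv : Orthonormal ℂ v) (j : Fin 2) : H →L[ℂ] H :=
  ketBra (hφ.comp (Sigma.mk j) sigma_mk_injective) (hv.comp (Sigma.mk j) sigma_mk_injective)

end TwoStates

end SeqDisc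

end

/-! Write `X` for the Helstrom operator and let `f T` be the trace of `T` after all receivers have
reported outcome `0`. Instruments are positive and preserve the total trace, so on a positive
operator the probabilities of the two unanimous outcomes add up to at most its trace. Applied to `ρ
1`, this bounds the success probability by `q 1 + f X`. Since `|X| - X` and `|X| + X` are positive,
`f X ≤ f |X|` and `f (|X| + X) ≤ tr (|X| + X)` (real parts throughout). Adding these gives `2 f X ≤
‖X‖₁ + q 0 - q 1`, which is the Helstrom bound (`successProb_le_helstromBound`).

Equality needs only Kraus operators of the first receiver with `star (K j) * K j = P₀(j)`, and later
ones with `L j * K j = K j`. The later receivers then repeat the first outcome without disturbing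
the state (`consecutive_hasKraus`), and the success probability is `q 1 + tr (P₀ X P₀)` with `P₀`
the first projection. Trace class operators are compact, so the eigenvectors of `X` span a dense
subspace. Checking on them gives `2 P₀ X P₀ = |X| + X` (`two_smul_positive_compression`). Both
protocols of the theorem are instances of this pattern.

The analytic input is that the trace class is a star-closed two-sided ideal, by a dual description
of the trace norm, and that `tr (K T K†)` depends on `K` only through `K† K`. For positive `T` the
latter follows from the identity of this trace with the squared Hilbert-Schmidt norm of `K √T`. -/

noncomputable section

namespace SeqDisc

/-! ### Trace ideal, trace functional and pure instruments -/

section TraceIdeal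

variable {H : Type*} [NormedAddCommGroup H] [InnerProductSpace ℂ H] [CompleteSpace H]

/-- With `S = √|A|` and `A ≈ V |A|`, each term is close to `⟪S V†U e, S W e⟫`. The AM-GM inequality
leaves two Hilbert-Schmidt norms, and right multiplication of `S` by a contraction does not increase
them. The second contraction `W` is what later handles right factors and adjoints. -/
lemma sum_norm_inner_apply_le (A U W : H →L[ℂ] H) (hU : ‖U‖ ≤ 1) (hW : ‖W‖ ≤ 1)
    (F : Finset (basisIndex H)) :
    ∑ i ∈ F, ENNReal.ofReal ‖⟪U (onb H i), A (W (onb H i))⟫_ℂ‖ ≤ traceNorm A := by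
  refine ENNReal.le_of_forall_pos_le_add fun η hη hfin => ?_
  -- The polar error is at most `δ` per index, so `F.card * δ ≤ η` in total; the `+ 1` covers empty
  -- `F`.
  set δ : ℝ := η / (F.card + 1) with hδ
  have hδ0 : 0 < δ := by positivity
  obtain ⟨V, hV, hV2, -⟩ := exists_approx_polar A hδ0
  set S := absSqrt A with hS
  have hSV : ‖star V * U‖ ≤ 1 :=
    (norm_mul_le _ _).trans (mul_le_one₀ (by rwa [norm_star]) (norm_nonneg _) hU)
  have key : ∀ i, ‖⟪U (onb H i), A (W (onb H i))⟫_ℂ‖ ≤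
      (1 / 2) * ‖(S * (star V * U)) (onb H i)‖ ^ 2 + (1 / 2) * ‖(S * W) (onb H i)‖ ^ 2 + δ := by
    intro i
    set e := onb H i
    have he : ‖e‖ = 1 := (onb H).orthonormal.1 i
    have h1 : ⟪U e, A (W e)⟫_ℂ = ⟪(S * (star V * U)) e, S (W e)⟫_ℂ
        + ⟪U e, (A - V * CFC.abs A) (W e)⟫_ℂ := by
      have : ⟪(S * (star V * U)) e, S (W e)⟫_ℂ = ⟪U e, (V * CFC.abs A) (W e)⟫_ℂ := by
        simp only [mul_apply_eq_comp]
        rw [← inner_abs, ContinuousLinearMap.star_eq_adjoint,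
          ContinuousLinearMap.adjoint_inner_left]
      rw [this, ← inner_add_right]
      simp
    have h2 : ‖⟪U e, (A - V * CFC.abs A) (W e)⟫_ℂ‖ ≤ δ := by
      refine (norm_inner_le_norm _ _).trans ?_
      have a1 := (U.le_of_opNorm_le hU e)
      have a2 := ((A - V * CFC.abs A).le_of_opNorm_le hV2 (W e))
      have a3 := (W.le_of_opNorm_le hW e)
      rw [he, mul_one] at a1 a3
      have a4 : ‖(A - V * CFC.abs A) (W e)‖ ≤ δ := by nlinarith
      nlinarith [norm_nonneg (U e), norm_nonneg ((A - V * CFC.abs A) (W e))]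
    have h3 := norm_inner_le_norm (𝕜 := ℂ) ((S * (star V * U)) e) ((S * W) e)
    rw [h1]
    refine (norm_add_le _ _).trans ?_
    change ‖⟪(S * (star V * U)) e, (S * W) e⟫_ℂ‖ + _ ≤ _
    nlinarith [sq_nonneg (‖(S * (star V * U)) e‖ - ‖(S * W) e‖)]
  have half : ENNReal.ofReal (1 / 2) * traceNorm A + ENNReal.ofReal (1 / 2) * traceNorm A
      = traceNorm A := by
    rw [← add_mul, ← ENNReal.ofReal_add (by norm_num) (by norm_num)]; norm_num
  calc ∑ i ∈ F, ENNReal.ofReal ‖⟪U (onb H i), A (W (onb H i))⟫_ℂ‖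
      ≤ ∑ i ∈ F, (ENNReal.ofReal (1 / 2) * ENNReal.ofReal (‖(S * (star V * U)) (onb H i)‖ ^ 2)
          + ENNReal.ofReal (1 / 2) * ENNReal.ofReal (‖(S * W) (onb H i)‖ ^ 2)
          + ENNReal.ofReal δ) := by
        refine Finset.sum_le_sum fun i _ => (ENNReal.ofReal_le_ofReal (key i)).trans ?_
        rw [ENNReal.ofReal_add (by positivity) hδ0.le, ENNReal.ofReal_add (by positivity)
          (by positivity), ENNReal.ofReal_mul (by norm_num), ENNReal.ofReal_mul (by norm_num)]
    _ = ENNReal.ofReal (1 / 2) * ∑ i ∈ F, ENNReal.ofReal (‖(S * (star V * U)) (onb H i)‖ ^ 2)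
          + ENNReal.ofReal (1 / 2) * ∑ i ∈ F, ENNReal.ofReal (‖(S * W) (onb H i)‖ ^ 2)
          + F.card * ENNReal.ofReal δ := by
        rw [Finset.sum_add_distrib, Finset.sum_add_distrib, Finset.mul_sum, Finset.mul_sum]
        simp
    _ ≤ ENNReal.ofReal (1 / 2) * traceNorm A + ENNReal.ofReal (1 / 2) * traceNorm A + η := by
        gcongr
        · refine (ENNReal.sum_le_tsum F).trans ?_
          rw [traceNorm_eq_hsSq]
          exact hsSq_mul_le_right S _ hSV
        · refine (ENNReal.sum_le_tsum F).trans ?_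
          rw [traceNorm_eq_hsSq]
          exact hsSq_mul_le_right S _ hW
        · rw [← ENNReal.ofReal_natCast, ← ENNReal.ofReal_mul (by positivity),
            ← ENNReal.ofReal_coe_nnreal]
          refine ENNReal.ofReal_le_ofReal ?_
          rw [hδ, mul_div_assoc', div_le_iff₀ (by positivity)]
          nlinarith [η.coe_nonneg]
    _ = traceNorm A + η := by rw [half]

/-- An approximate polar factor `U` of `B` nearly turns `⟪U e, B e⟫` into `⟪e, |B| e⟫`. Together
with the preceding bound this makes the trace norm a supremum over contractions. -/
lemma traceNorm_le_of_forall_sum_le (B : H →L[ℂ] H) (c : ℝ≥0∞)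
    (h : ∀ (U : H →L[ℂ] H), ‖U‖ ≤ 1 → ∀ F : Finset (basisIndex H),
      ∑ i ∈ F, ENNReal.ofReal ‖⟪U (onb H i), B (onb H i)⟫_ℂ‖ ≤ c) :
    traceNorm B ≤ c := by
  rw [traceNorm, ENNReal.tsum_eq_iSup_sum]
  refine iSup_le fun F => ENNReal.le_of_forall_pos_le_add fun η hη hfin => ?_
  set δ : ℝ := η / (F.card + 1) with hδ
  have hδ0 : 0 < δ := by positivity
  obtain ⟨U, hU, -, hU2⟩ := exists_approx_polar B hδ0
  have key : ∀ i, (⟪onb H i, CFC.abs B (onb H i)⟫_ℂ).re ≤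
      ‖⟪U (onb H i), B (onb H i)⟫_ℂ‖ + δ := by
    intro i
    set e := onb H i
    have he : ‖e‖ = 1 := (onb H).orthonormal.1 i
    have h1 : ⟪e, CFC.abs B e⟫_ℂ = ⟪U e, B e⟫_ℂ + ⟪e, (CFC.abs B - star U * B) e⟫_ℂ := by
      rw [← ContinuousLinearMap.adjoint_inner_right, ← ContinuousLinearMap.star_eq_adjoint,
        ← inner_add_right]
      simp
    have h2 : ‖⟪e, (CFC.abs B - star U * B) e⟫_ℂ‖ ≤ δ := by
      refine (norm_inner_le_norm _ _).trans ?_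
      have a2 := ((CFC.abs B - star U * B).le_of_opNorm_le hU2 e)
      rw [he] at a2 ⊢
      linarith
    refine (Complex.re_le_norm _).trans ?_
    rw [h1]
    exact (norm_add_le _ _).trans (by gcongr)
  calc ∑ i ∈ F, ENNReal.ofReal (⟪onb H i, CFC.abs B (onb H i)⟫_ℂ).re
      ≤ ∑ i ∈ F, (ENNReal.ofReal ‖⟪U (onb H i), B (onb H i)⟫_ℂ‖ + ENNReal.ofReal δ) := by
        refine Finset.sum_le_sum fun i _ => (ENNReal.ofReal_le_ofReal (key i)).trans ?_
        rw [ENNReal.ofReal_add (by positivity) hδ0.le]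
    _ = ∑ i ∈ F, ENNReal.ofReal ‖⟪U (onb H i), B (onb H i)⟫_ℂ‖
          + F.card * ENNReal.ofReal δ := by
        rw [Finset.sum_add_distrib]; simp
    _ ≤ c + η := by
        gcongr
        · exact h U hU F
        · rw [← ENNReal.ofReal_natCast, ← ENNReal.ofReal_mul (by positivity),
            ← ENNReal.ofReal_coe_nnreal]
          refine ENNReal.ofReal_le_ofReal ?_
          rw [hδ, mul_div_assoc', div_le_iff₀ (by positivity)]
          nlinarith [η.coe_nonneg]

lemma traceNorm_mul_mul_le (A T B : H →L[ℂ] H) (hA : ‖A‖ ≤ 1) (hB : ‖B‖ ≤ 1) :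
    traceNorm (A * T * B) ≤ traceNorm T := by
  refine traceNorm_le_of_forall_sum_le _ _ fun U hU F => ?_
  -- The left factor is moved to the other side of the inner product, where it is absorbed into the
  -- test contraction.
  have h := sum_norm_inner_apply_le T (star A * U) B
    ((norm_mul_le _ _).trans (mul_le_one₀ (by rwa [norm_star]) (norm_nonneg _) hU)) hB F
  refine le_of_eq_of_le (Finset.sum_congr rfl fun i _ => ?_) h
  simp only [mul_apply_eq_comp]
  rw [ContinuousLinearMap.star_eq_adjoint, ContinuousLinearMap.adjoint_inner_left]

lemma traceNorm_star_le (T : H →L[ℂ] H) : traceNorm (star T) ≤ traceNorm T := by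
  refine traceNorm_le_of_forall_sum_le _ _ fun U hU F => ?_
  have h := sum_norm_inner_apply_le T 1 U ContinuousLinearMap.norm_id_le hU F
  refine le_of_eq_of_le (Finset.sum_congr rfl fun i _ => ?_) h
  rw [ContinuousLinearMap.star_eq_adjoint, ContinuousLinearMap.adjoint_inner_right,
    ← inner_conj_symm, RCLike.norm_conj]
  rfl

lemma mem_traceClass {T : H →L[ℂ] H} : T ∈ TraceClass H ↔ traceNorm T < ∞ := Iff.rfl

lemma star_mem_traceClass {T : H →L[ℂ] H} (hT : T ∈ TraceClass H) : star T ∈ TraceClass H :=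
  (traceNorm_star_le T).trans_lt hT

lemma abs_mem_traceClass {T : H →L[ℂ] H} (hT : T ∈ TraceClass H) : CFC.abs T ∈ TraceClass H := by
  rw [mem_traceClass, traceNorm, CFC.cfcAbs_cfcAbs]
  exact hT

lemma summable_inner_onb {T : H →L[ℂ] H} (hT : T ∈ TraceClass H) :
    Summable fun i => ⟪onb H i, T (onb H i)⟫_ℂ := by
  refine Summable.of_norm ?_
  have h : ∑' i, ENNReal.ofReal ‖⟪onb H i, T (onb H i)⟫_ℂ‖ ≤ traceNorm T := by
    rw [ENNReal.tsum_eq_iSup_sum]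
    exact iSup_le fun F => sum_norm_inner_le T 1 ContinuousLinearMap.norm_id_le F
  have h2 := ENNReal.summable_toReal (h.trans_lt hT).ne
  simpa [ENNReal.toReal_ofReal (norm_nonneg _)] using h2

variable (H) in
/-- The trace as a linear functional on the trace class operators. -/
def traceLinear : TraceClass H →ₗ[ℂ] ℂ where
  toFun T := opTrace (T : H →L[ℂ] H)
  map_add' A B := by
    simp only [opTrace, Submodule.coe_add, add_apply, inner_add_right]
    exact (summable_inner_onb A.2).tsum_add (summable_inner_onb B.2)
  map_smul' c A := by
    simp only [opTrace, Submodule.coe_smul, smul_apply, inner_smul_right,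
      RingHom.id_apply, smul_eq_mul]
    exact tsum_mul_left

lemma traceLinear_apply (T : TraceClass H) : traceLinear H T = opTrace (T : H →L[ℂ] H) := rfl

lemma nonneg_iff_inner {T : H →L[ℂ] H} : 0 ≤ T ↔ ∀ x, 0 ≤ ⟪x, T x⟫_ℂ := by
  rw [ContinuousLinearMap.nonneg_iff_isPositive]
  refine ⟨fun h x => h.inner_nonneg_right x, fun h => ?_⟩
  rw [ContinuousLinearMap.isPositive_iff_complex]
  intro x
  have := Complex.le_def.1 (h x)
  simp only [Complex.zero_re, Complex.zero_im] at this
  rw [← inner_conj_symm (T x) x]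
  refine ⟨Complex.ext ?_ ?_, ?_⟩
  · simp only [RCLike.re_to_complex, Complex.ofReal_re]
  · rw [Complex.conj_im, ← this.2, neg_zero]
    exact Complex.ofReal_im _
  · rw [RCLike.re_to_complex, Complex.conj_re]
    exact this.1

lemma opTrace_nonneg {T : H →L[ℂ] H} (hT : 0 ≤ T) : 0 ≤ (opTrace T).re := by
  have : 0 ≤ opTrace T := tsum_nonneg fun i => nonneg_iff_inner.1 hT _
  exact (Complex.le_def.1 this).1

lemma toReal_traceNorm {T : H →L[ℂ] H} (hT : T ∈ TraceClass H) :
    (traceNorm T).toReal = (opTrace (CFC.abs T)).re := by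
  rw [opTrace, Complex.re_tsum (summable_inner_onb (abs_mem_traceClass hT)), traceNorm,
    ENNReal.tsum_toReal_eq (fun _ => ENNReal.ofReal_ne_top)]
  refine tsum_congr fun i => ENNReal.toReal_ofReal ?_
  rw [re_inner_abs]; positivity

/-- The diagonal terms are `‖√T K† e‖²`, and the Hilbert-Schmidt norm is invariant under adjoints.
Trace class membership is not needed: if the series diverges, both sides take the default value `0`.
-/
lemma opTrace_conj_eq_hsSq {T : H →L[ℂ] H} (h0 : 0 ≤ T)
    (K : H →L[ℂ] H) :
    opTrace (K * T * star K) = ((hsSq (K * absSqrt T)).toReal : ℂ) := by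
  rw [← hsSq_star, star_mul, absSqrt_star, hsSq,
    ENNReal.tsum_toReal_eq (fun _ => ENNReal.ofReal_ne_top), opTrace, Complex.ofReal_tsum]
  refine tsum_congr fun i => ?_
  rw [ENNReal.toReal_ofReal (by positivity)]
  conv_lhs => rw [← CFC.abs_of_nonneg T h0]
  simp only [mul_apply_eq_comp]
  rw [← ContinuousLinearMap.adjoint_inner_left, ← ContinuousLinearMap.star_eq_adjoint, inner_abs,
    inner_self_eq_norm_sq_to_K]
  norm_cast

lemma norm_sq_apply_eq (K : H →L[ℂ] H) (x : H) : ((‖K x‖ ^ 2 : ℝ) : ℂ) = ⟪x, (star K * K) x⟫_ℂ := by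
  rw [mul_apply_eq_comp, ContinuousLinearMap.star_eq_adjoint,
    ContinuousLinearMap.adjoint_inner_right, inner_self_eq_norm_sq_to_K]
  norm_cast

lemma hsSq_congr_left {K L : H →L[ℂ] H} (h : star K * K = star L * L) (S : H →L[ℂ] H) :
    hsSq (K * S) = hsSq (L * S) := by
  refine tsum_congr fun i => ?_
  congr 1
  have := (norm_sq_apply_eq K (S (onb H i))).trans
    (h ▸ (norm_sq_apply_eq L (S (onb H i))).symm)
  exact_mod_cast this

/-- This replaces cyclicity of the trace: an outcome probability depends only on the effect `K† K`.
-/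
lemma opTrace_conj_congr {T : H →L[ℂ] H} (h0 : 0 ≤ T)
    {K L : H →L[ℂ] H} (h : star K * K = star L * L) :
    opTrace (K * T * star K) = opTrace (L * T * star L) := by
  rw [opTrace_conj_eq_hsSq h0, opTrace_conj_eq_hsSq h0, hsSq_congr_left h]

lemma hsSq_absSqrt_ne_top {T : H →L[ℂ] H} (hT : T ∈ TraceClass H) : hsSq (absSqrt T) ≠ ∞ := by
  rw [← traceNorm_eq_hsSq]; exact hT.ne

variable {Ω : Type*} [Fintype Ω]

lemma sum_norm_sq_apply {K : Ω → H →L[ℂ] H} (hK : ∑ ω, star (K ω) * K ω = 1) (x : H) :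
    ∑ ω, ‖K ω x‖ ^ 2 = ‖x‖ ^ 2 := by
  have h : ((∑ ω, ‖K ω x‖ ^ 2 : ℝ) : ℂ) = ((‖x‖ ^ 2 : ℝ) : ℂ) := by
    rw [Complex.ofReal_sum]
    simp_rw [norm_sq_apply_eq]
    rw [← inner_sum, ← sum_apply, hK, one_apply_eq_self, inner_self_eq_norm_sq_to_K]
    norm_cast
  exact_mod_cast h

lemma norm_le_one_of_sum_star_mul_self {K : Ω → H →L[ℂ] H} (hK : ∑ ω, star (K ω) * K ω = 1)
    (ω : Ω) : ‖K ω‖ ≤ 1 := by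
  refine ContinuousLinearMap.opNorm_le_bound _ zero_le_one fun x => ?_
  rw [one_mul, ← sq_le_sq₀ (norm_nonneg _) (norm_nonneg _), ← sum_norm_sq_apply hK x]
  exact Finset.single_le_sum (f := fun ω => ‖K ω x‖ ^ 2) (fun _ _ => by positivity)
    (Finset.mem_univ ω)

lemma sum_hsSq_mul {K : Ω → H →L[ℂ] H} (hK : ∑ ω, star (K ω) * K ω = 1) (S : H →L[ℂ] H) :
    ∑ ω, hsSq (K ω * S) = hsSq S := by
  unfold hsSq
  rw [← Summable.tsum_finsetSum (fun _ _ => ENNReal.summable)]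
  refine tsum_congr fun i => ?_
  rw [← ENNReal.ofReal_sum_of_nonneg (fun _ _ => by positivity)]
  congr 1
  exact sum_norm_sq_apply hK _

/-- The linear map `T ↦ K T K†` on the trace class operators, for a contraction `K`. -/
def conjMap (K : H →L[ℂ] H) (hK : ‖K‖ ≤ 1) : TraceClass H →ₗ[ℂ] TraceClass H where
  toFun T := ⟨K * (T : H →L[ℂ] H) * star K,
    (traceNorm_mul_mul_le K _ (star K) hK (by rwa [norm_star])).trans_lt T.2⟩
  map_add' A B := by ext1; simp [mul_add, add_mul]
  map_smul' c A := by ext1; simp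

lemma coe_conjMap (K : H →L[ℂ] H) (hK : ‖K‖ ≤ 1) (T : TraceClass H) :
    (conjMap K hK T : H →L[ℂ] H) = K * (T : H →L[ℂ] H) * star K := rfl

/-- Linear functionals on the trace class operators are determined by positive operators. -/
lemma linearMap_ext_nonneg {f g : TraceClass H →ₗ[ℂ] ℂ}
    (h : ∀ T : TraceClass H, 0 ≤ (T : H →L[ℂ] H) → f T = g T) : f = g := by
  have hsa : ∀ T : TraceClass H, IsSelfAdjoint (T : H →L[ℂ] H) → f T = g T := by
    intro T hT
    have hA := abs_mem_traceClass T.2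
    set A : TraceClass H := ⟨_, hA⟩ with hAdef
    -- Both `|T|` and `|T| + T = 2 T⁺` are positive, and their difference is `T`.
    have h1 := h (A + T) (by
      change 0 ≤ CFC.abs (T : H →L[ℂ] H) + T
      rw [CFC.abs_add_self _ hT]
      exact nsmul_nonneg (CFC.posPart_nonneg _) 2)
    have h2 := h A (CFC.abs_nonneg _)
    rw [map_add, map_add, h2] at h1
    exact add_left_cancel h1
  ext T
  set R : TraceClass H := ⟨_, star_mem_traceClass T.2⟩ with hR
  -- Cartesian decomposition: `T + T†` and `i (T - T†)` are self-adjoint and determine `T`.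
  have h1 := hsa (T + R) (by
    change star ((T : H →L[ℂ] H) + star (T : H →L[ℂ] H)) = T + star (T : H →L[ℂ] H)
    rw [star_add, star_star, add_comm])
  have h2 := hsa (Complex.I • (T - R)) (by
    change star (Complex.I • ((T : H →L[ℂ] H) - star (T : H →L[ℂ] H))) =
      Complex.I • ((T : H →L[ℂ] H) - star (T : H →L[ℂ] H))
    rw [star_smul, star_sub, star_star, Complex.star_def, Complex.conj_I, neg_smul, ← smul_neg,
      neg_sub])
  rw [map_smul, map_smul] at h2
  have h3 := smul_right_injective ℂ Complex.I_ne_zero h2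
  rw [map_sub, map_sub] at h3
  rw [map_add, map_add] at h1
  linear_combination (h1 + h3) / 2

lemma sum_opTrace_conj {K : Ω → H →L[ℂ] H} (hK : ∑ ω, star (K ω) * K ω = 1) (T : TraceClass H) :
    ∑ ω, opTrace (K ω * (T : H →L[ℂ] H) * star (K ω)) = opTrace (T : H →L[ℂ] H) := by
  have hn := norm_le_one_of_sum_star_mul_self hK
  have : ∑ ω, traceLinear H ∘ₗ conjMap (K ω) (hn ω) = traceLinear H := by
    refine linearMap_ext_nonneg fun T h0 => ?_
    rw [LinearMap.sum_apply]
    simp only [LinearMap.comp_apply, traceLinear_apply, coe_conjMap]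
    simp_rw [opTrace_conj_eq_hsSq h0]
    have h1 := opTrace_conj_eq_hsSq h0 1
    simp only [one_mul, star_one, mul_one] at h1
    rw [h1, ← sum_hsSq_mul hK, ENNReal.toReal_sum, Complex.ofReal_sum]
    intro ω _
    exact ((hsSq_mul_le_left _ _ (hn ω)).trans_lt (hsSq_absSqrt_ne_top T.2).lt_top).ne
  have := DFunLike.congr_fun this T
  rwa [LinearMap.sum_apply] at this

/-- The pure instrument with Kraus operators `K`. -/
def krausInstrument (K : Ω → H →L[ℂ] H) (hK : ∑ ω, star (K ω) * K ω = 1) :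
    StateInstrument H Ω where
  map ω := conjMap (K ω) (norm_le_one_of_sum_star_mul_self hK ω)
  completelyPositive ω n T hT x := by
    -- Moving `K` across the inner product evaluates the original block matrix at the vectors `K†
    -- xᵢ`.
    refine (hT fun i => star (K ω) (x i)).trans_eq ?_
    refine Finset.sum_congr rfl fun i _ => Finset.sum_congr rfl fun k _ => ?_
    rw [coe_conjMap, mul_apply_eq_comp, mul_apply_eq_comp, ContinuousLinearMap.star_eq_adjoint,
      ContinuousLinearMap.adjoint_inner_left]
  bounded ω := ⟨1, fun T => by
    have h := norm_le_one_of_sum_star_mul_self hK ω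
    rw [ENNReal.coe_one, one_mul]
    exact traceNorm_mul_mul_le _ _ _ h (by rwa [norm_star])⟩
  trace_preserving T := sum_opTrace_conj hK T

lemma krausInstrument_hasKraus (K : Ω → H →L[ℂ] H) (hK : ∑ ω, star (K ω) * K ω = 1) :
    (krausInstrument K hK).HasKraus K := fun _ _ => rfl

end TraceIdeal

/-! ### Compactness and the positive spectral subspace -/

section SpectralDecomposition

variable {H : Type*} [NormedAddCommGroup H] [InnerProductSpace ℂ H] [CompleteSpace H]

open Module.End Filter Topology

/-- Parseval gives `‖A y‖² = ∑ⱼ |⟪A† eⱼ, y⟫|²`, and Cauchy-Schwarz bounds each term by `‖A† eⱼ‖²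
‖y‖²`. -/
lemma opNorm_sq_le_hsSq {A : H →L[ℂ] H} (hA : hsSq A ≠ ∞) :
    ‖A‖ ^ 2 ≤ (hsSq A).toReal := by
  have h : ‖A‖ ≤ √(hsSq A).toReal := by
    refine ContinuousLinearMap.opNorm_le_bound _ (Real.sqrt_nonneg _) fun y => ?_
    have h1 : ENNReal.ofReal (‖A y‖ ^ 2) ≤ hsSq A * ENNReal.ofReal (‖y‖ ^ 2) := by
      rw [ofReal_norm_sq_eq_tsum, ← hsSq_star, hsSq, ← ENNReal.tsum_mul_right]
      refine ENNReal.tsum_le_tsum fun j => ?_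
      rw [← ENNReal.ofReal_mul (by positivity), ← mul_pow,
        ← ContinuousLinearMap.adjoint_inner_left, ← ContinuousLinearMap.star_eq_adjoint]
      exact ENNReal.ofReal_le_ofReal (by gcongr; exact norm_inner_le_norm _ _)
    rw [← ENNReal.ofReal_toReal hA, ← ENNReal.ofReal_mul ENNReal.toReal_nonneg,
      ENNReal.ofReal_le_ofReal_iff (by positivity)] at h1
    refine le_of_sq_le_sq ?_ (by positivity)
    rwa [mul_pow, Real.sq_sqrt ENNReal.toReal_nonneg]
  calc ‖A‖ ^ 2 ≤ √(hsSq A).toReal ^ 2 := by gcongr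
    _ = _ := Real.sq_sqrt ENNReal.toReal_nonneg

/-- Hilbert-Schmidt operators are compact. -/
lemma isCompactOperator_of_hsSq {A : H →L[ℂ] H} (hA : hsSq A ≠ ∞) : IsCompactOperator A := by
  classical
  -- Finite-rank truncations: the squared Hilbert-Schmidt norm of `A - B F` is a tail of the
  -- convergent series `hsSq A`, so `B F → A` in operator norm.
  set B : Finset (basisIndex H) → H →L[ℂ] H := fun F =>
    ∑ i ∈ F, (innerSL ℂ (onb H i)).smulRight (A (onb H i)) with hB
  have hBc : ∀ F, IsCompactOperator (B F) := fun F => by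
    refine Submodule.sum_mem (compactOperator (RingHom.id ℂ) H H) fun i _ => ?_
    exact (isCompactOperator_of_locallyCompactSpace_dom (innerSL ℂ (onb H i))).clm_comp
      (ContinuousLinearMap.toSpanSingleton ℂ (A (onb H i)))
  have hBe : ∀ F j, B F (onb H j) = if j ∈ F then A (onb H j) else 0 := fun F j => by
    simp only [hB, sum_apply, ContinuousLinearMap.smulRight_apply, innerSL_apply_apply,
      orthonormal_iff_ite.1 (onb H).orthonormal, ite_smul, one_smul, zero_smul]
    rw [Finset.sum_ite_eq' F j]
  have hs : ∀ F, hsSq (A - B F) =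
      ∑' i : {i // i ∉ F}, ENNReal.ofReal (‖A (onb H i)‖ ^ 2) := fun F => by
    have := tsum_subtype {i | i ∉ F} fun i => ENNReal.ofReal (‖A (onb H i)‖ ^ 2)
    refine Eq.trans ?_ this.symm
    refine tsum_congr fun i => ?_
    rw [sub_apply, hBe]
    by_cases h : i ∈ F <;> simp [h]
  have h0 : Tendsto (fun F => hsSq (A - B F)) atTop (𝓝 0) := by
    simp_rw [hs]
    exact ENNReal.tendsto_tsum_compl_atTop_zero hA
  have hfin : ∀ F, hsSq (A - B F) ≠ ∞ := fun F => by
    rw [hs]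
    exact ((ENNReal.tsum_comp_le_tsum_of_injective Subtype.val_injective
      fun i => ENNReal.ofReal (‖A (onb H i)‖ ^ 2)).trans_lt hA.lt_top).ne
  refine isCompactOperator_of_tendsto (l := atTop) (F := B) ?_ (Eventually.of_forall hBc)
  rw [tendsto_iff_norm_sub_tendsto_zero]
  have h1 := (ENNReal.tendsto_toReal ENNReal.zero_ne_top).comp h0
  have h2 := (Real.continuous_sqrt.tendsto _).comp h1
  simp only [ENNReal.toReal_zero, Real.sqrt_zero] at h2
  refine squeeze_zero (fun _ => norm_nonneg _) (fun F => ?_) h2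
  rw [norm_sub_rev]
  exact Real.le_sqrt_of_sq_le (opNorm_sq_le_hsSq (hfin F))

lemma norm_abs_apply (A : H →L[ℂ] H) (x : H) : ‖CFC.abs A x‖ = ‖A x‖ := by
  have h := (norm_sq_apply_eq (CFC.abs A) x).trans
    (((IsSelfAdjoint.of_nonneg (CFC.abs_nonneg A)).star_eq.symm ▸ CFC.abs_mul_abs A :
      star (CFC.abs A) * CFC.abs A = star A * A) ▸ (norm_sq_apply_eq A x).symm)
  have h2 : ‖CFC.abs A x‖ ^ 2 = ‖A x‖ ^ 2 := by exact_mod_cast h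
  exact (sq_eq_sq₀ (norm_nonneg _) (norm_nonneg _)).1 h2

/-- Trace class operators are compact. -/
lemma isCompactOperator_of_mem_traceClass {A : H →L[ℂ] H} (hA : A ∈ TraceClass H) :
    IsCompactOperator A := by
  -- With `S = √|A|`, `‖A e‖ = ‖S (S e)‖ ≤ ‖S‖ ‖S e‖`, so `A` is Hilbert-Schmidt because `S` is.
  refine isCompactOperator_of_hsSq (ne_top_of_le_ne_top
    (ENNReal.mul_ne_top (ENNReal.ofReal_ne_top (r := ‖absSqrt A‖ ^ 2)) (hsSq_absSqrt_ne_top hA)) ?_)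
  unfold hsSq
  rw [← ENNReal.tsum_mul_left]
  refine ENNReal.tsum_le_tsum fun i => ?_
  rw [← ENNReal.ofReal_mul (by positivity), ← mul_pow]
  refine ENNReal.ofReal_le_ofReal ?_
  rw [← norm_abs_apply, ← absSqrt_mul_self]
  gcongr
  exact (absSqrt A).le_opNorm _

/-- From `|X|² x = t² x`, the vector `y = |X| x - |t| x` satisfies `|X| y = -|t| y`. For `t ≠ 0`,
positivity of `|X|` forces `y = 0`. -/
lemma abs_apply_eigenvector {X : H →L[ℂ] H} (hX : IsSelfAdjoint X) {t : ℝ} {x : H}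
    (hx : X x = (t : ℂ) • x) : CFC.abs X x = ((|t| : ℝ) : ℂ) • x := by
  set A := CFC.abs X with hA
  have hA0 : 0 ≤ A := CFC.abs_nonneg X
  rcases eq_or_ne t 0 with rfl | ht
  · have h1 : ‖A x‖ = 0 := by rw [norm_abs_apply, hx]; simp
    rw [norm_eq_zero.1 h1]; simp
  · have hAA : A (A x) = ((|t| : ℝ) : ℂ) • ((|t| : ℝ) : ℂ) • x := by
      have : A (A x) = X (X x) := by
        rw [← mul_apply_eq_comp, hA, CFC.abs_mul_abs, hX.star_eq, mul_apply_eq_comp]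
      rw [this, hx, map_smul, hx, smul_smul, smul_smul, ← Complex.ofReal_mul, ← Complex.ofReal_mul,
        abs_mul_abs_self]
    set y := A x - ((|t| : ℝ) : ℂ) • x with hy
    have hAy : A y = -(((|t| : ℝ) : ℂ) • y) := by
      rw [hy, map_sub, map_smul, hAA, smul_sub]
      abel
    have h1 := (nonneg_iff_inner.1 hA0 y)
    rw [hAy, inner_neg_right, inner_smul_right, inner_self_eq_norm_sq_to_K] at h1
    have h2 : 0 ≤ -(|t| * ‖y‖ ^ 2) := by
      have h3 := (Complex.le_def.1 h1).1
      have h4 : (-(((|t| : ℝ) : ℂ) * ((‖y‖ : ℝ) : ℂ) ^ 2)).re = -(|t| * ‖y‖ ^ 2) := by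
        rw [← Complex.ofReal_pow, ← Complex.ofReal_mul, ← Complex.ofReal_neg, Complex.ofReal_re]
      rw [← h4]; exact h3
    have h5 : 0 < |t| := abs_pos.2 ht
    have h6 : ‖y‖ = 0 := by
      by_contra hne
      have : 0 < ‖y‖ ^ 2 := by positivity
      nlinarith
    exact sub_eq_zero.1 (norm_eq_zero.1 h6)

lemma mem_positiveSubspace {X : H →L[ℂ] H} {t : ℝ} (ht : 0 < t) {x : H}
    (hx : X x = (t : ℂ) • x) : x ∈ positiveSubspace X :=
  Submodule.le_topologicalClosure _ <| Submodule.mem_iSup_of_mem t <|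
    Submodule.mem_iSup_of_mem ht <| mem_eigenspace_iff.2 hx

/-- Eigenvectors of a self-adjoint operator for distinct eigenvalues are orthogonal, and `xᗮ` is
closed. The case `t = 0` is included, so the kernel belongs to the second projection. -/
lemma mem_positiveSubspace_orthogonal {X : H →L[ℂ] H} (hX : IsSelfAdjoint X) {t : ℝ} (ht : t ≤ 0)
    {x : H} (hx : X x = (t : ℂ) • x) : x ∈ (positiveSubspace X)ᗮ := by
  have h : positiveSubspace X ≤ (ℂ ∙ x)ᗮ := by
    refine Submodule.topologicalClosure_minimal _ (iSup₂_le fun s hs y hy => ?_)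
      (Submodule.isClosed_orthogonal _)
    have hy : X y = (s : ℂ) • y := mem_eigenspace_iff.1 hy
    rw [Submodule.mem_orthogonal_singleton_iff_inner_right]
    have h1 : ⟪X x, y⟫_ℂ = ⟪x, X y⟫_ℂ := hX.isSymmetric x y
    rw [hx, hy, inner_smul_left, inner_smul_right, Complex.conj_ofReal] at h1
    have h2 : ((t - s : ℝ) : ℂ) * ⟪x, y⟫_ℂ = 0 := by push_cast; linear_combination h1
    refine (mul_eq_zero.1 h2).resolve_left ?_
    exact_mod_cast (by linarith : t - s < 0).ne
  exact Submodule.orthogonal_le h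
    (Submodule.le_orthogonal_orthogonal _ (Submodule.mem_span_singleton_self x))

/-- The compression of a self-adjoint trace class operator to its positive spectral subspace is its
positive part. -/
lemma two_smul_positive_compression {X : H →L[ℂ] H} (hX : IsSelfAdjoint X)
    (hT : X ∈ TraceClass H) :
    (2 : ℂ) • ((positiveSubspace X).starProjection * X * (positiveSubspace X).starProjection) =
      CFC.abs X + X := by
  set P := (positiveSubspace X).starProjection with hP
  have hbot := ContinuousLinearMap.orthogonalComplement_iSup_eigenspaces_eq_bot
    (isCompactOperator_of_mem_traceClass hT) hX.isSymmetric
  have htop := Submodule.topologicalClosure_eq_top_iff.2 hbot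
  set D := (2 : ℂ) • (P * X * P) - (CFC.abs X + X) with hD
  -- The closed kernel of `D` contains every eigenspace, and these span a dense subspace. On an
  -- eigenvector both sides of the identity are `2t` for `t > 0` and `0` otherwise.
  have hle : (⨆ μ, eigenspace (X : Module.End ℂ H) μ) ≤ D.ker := by
    refine iSup_le fun μ x hμ => ?_
    have hx : X x = μ • x := mem_eigenspace_iff.1 hμ
    rw [LinearMap.mem_ker]
    rcases eq_or_ne x 0 with rfl | hx0
    · simp
    have hconj := hX.isSymmetric.conj_eigenvalue_eq_self
      (hasEigenvalue_of_hasEigenvector ⟨hμ, hx0⟩)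
    obtain ⟨t, rfl⟩ := Complex.conj_eq_iff_real.1 hconj
    have habs := abs_apply_eigenvector hX hx
    change (2 : ℂ) • (P (X (P x))) - (CFC.abs X x + X x) = 0
    rw [habs, hx]
    rcases lt_or_ge 0 t with ht | ht
    · have hPx : P x = x := Submodule.starProjection_eq_self_iff.2 (mem_positiveSubspace ht hx)
      rw [hPx, hx, map_smul, hPx, abs_of_pos ht, two_smul, sub_self]
    · have hPx : P x = 0 := (Submodule.starProjection_apply_eq_zero_iff _).2
        (mem_positiveSubspace_orthogonal hX ht hx)
      rw [hPx, map_zero, map_zero, smul_zero, abs_of_nonpos ht, Complex.ofReal_neg, neg_smul,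
        neg_add_cancel, sub_zero]
  have hker := Submodule.topologicalClosure_minimal _ hle D.isClosed_ker
  rw [htop] at hker
  refine sub_eq_zero.1 (ContinuousLinearMap.ext fun x => ?_)
  exact LinearMap.mem_ker.1 (hker (Submodule.mem_top (x := x)))

end SpectralDecomposition

/-! ### Calculus of the operators `∑ᵢ |aᵢ⟩⟨bᵢ|` -/

section KetBra

variable {H : Type*} [NormedAddCommGroup H] [InnerProductSpace ℂ H] [CompleteSpace H]
variable {κ : Type*} {a b c : κ → H}

lemma star_ketBra (ha : Orthonormal ℂ a) (hb : Orthonormal ℂ b) :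
    star (ketBra ha hb) = ketBra hb ha := by
  rw [ContinuousLinearMap.star_eq_adjoint, ketBra, ketBra, ContinuousLinearMap.adjoint_comp,
    ContinuousLinearMap.adjoint_adjoint]

/-- The middle family cancels because its synthesis map is an isometry. -/
lemma ketBra_mul_ketBra (ha : Orthonormal ℂ a) (hb : Orthonormal ℂ b) (hc : Orthonormal ℂ c) :
    ketBra ha hb * ketBra hb hc = ketBra ha hc := by
  have h := (synthesis hb).adjoint_comp_self
  ext x
  change synthesis ha ((ContinuousLinearMap.adjoint (synthesis hb).toContinuousLinearMap ∘L
    (synthesis hb).toContinuousLinearMap)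
      (ContinuousLinearMap.adjoint (synthesis hc).toContinuousLinearMap x)) = _
  rw [h]
  rfl

lemma sum_blockKetBra {ι : Fin 2 → Type*} (φ : HilbertBasis (Σ j, ι j) ℂ H) :
    ∑ j, blockKetBra φ.orthonormal φ.orthonormal j = 1 := by
  ext x
  have h (j : Fin 2) : HasSum (fun i => φ.repr x ⟨j, i⟩ • φ ⟨j, i⟩)
      (blockKetBra φ.orthonormal φ.orthonormal j x) := by
    simp only [φ.repr_apply_apply]
    exact hasSum_ketBra _ _ x
  have h1 := (φ.hasSum_repr x).sigma h
  rw [sum_apply]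
  exact (hasSum_fintype _).unique h1

end KetBra

/-! ### Positivity, trace and Kraus form of sequential measurements -/

section Protocols

variable {H : Type*} [NormedAddCommGroup H] [InnerProductSpace ℂ H] [CompleteSpace H]
variable {Ω : Type*} [Fintype Ω]

lemma StateInstrument.map_nonneg (M : StateInstrument H Ω) (ω : Ω) {T : TraceClass H}
    (hT : 0 ≤ (T : H →L[ℂ] H)) : 0 ≤ (M.map ω T : H →L[ℂ] H) := by
  refine nonneg_iff_inner.2 fun x => ?_
  -- Positivity is complete positivity for `1 × 1` blocks.
  have h := M.completelyPositive ω 1 (fun _ _ => T) (fun x => by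
    simpa using nonneg_iff_inner.1 hT (x 0)) (fun _ => x)
  simpa using h

lemma consecutive_nonneg {N : ℕ} (M : Fin N → StateInstrument H Ω) (j : Fin N → Ω)
    {T : TraceClass H} (hT : 0 ≤ (T : H →L[ℂ] H)) :
    0 ≤ (consecutive N M j T : H →L[ℂ] H) := by
  induction N with
  | zero => exact hT
  | succ N ih => exact (M (Fin.last N)).map_nonneg _ (ih _ _)

lemma StateInstrument.sum_trace_re (M : StateInstrument H Ω) (T : TraceClass H) :
    ∑ ω, (opTrace (M.map ω T : H →L[ℂ] H)).re = (opTrace (T : H →L[ℂ] H)).re := by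
  rw [← M.trace_preserving T, Complex.re_sum]

lemma StateInstrument.trace_re_map_le (M : StateInstrument H Ω) (ω : Ω) {T : TraceClass H}
    (hT : 0 ≤ (T : H →L[ℂ] H)) :
    (opTrace (M.map ω T : H →L[ℂ] H)).re ≤ (opTrace (T : H →L[ℂ] H)).re := by
  rw [← M.sum_trace_re T]
  exact Finset.single_le_sum (f := fun ω => (opTrace (M.map ω T : H →L[ℂ] H)).re)
    (fun ω _ => opTrace_nonneg (M.map_nonneg ω hT)) (Finset.mem_univ ω)

/-- The probabilities that all receivers obtain the same outcome add up to at most one. -/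
lemma sum_trace_re_consecutive_le {N : ℕ} (hN : 1 ≤ N) (M : Fin N → StateInstrument H Ω)
    {T : TraceClass H} (hT : 0 ≤ (T : H →L[ℂ] H)) :
    ∑ ω, (opTrace (consecutive N M (fun _ => ω) T : H →L[ℂ] H)).re ≤
      (opTrace (T : H →L[ℂ] H)).re := by
  induction N, hN using Nat.le_induction with
  | base => exact ((M (Fin.last 0)).sum_trace_re T).le
  | succ N _ ih =>
    -- Each outcome of the last receiver can only lower the trace of a positive operator, so that
    -- receiver may be dropped.
    refine le_trans (Finset.sum_le_sum fun ω _ => ?_) (ih fun n => M n.castSucc)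
    exact (M (Fin.last N)).trace_re_map_le ω (consecutive_nonneg _ _ hT)

/-- After the first receiver the state is `K T K†`, which `L` fixes under conjugation since `L K =
K`. -/
lemma consecutive_hasKraus {N : ℕ} (hN : 1 ≤ N) {M : Fin N → StateInstrument H Ω}
    {K L : Ω → H →L[ℂ] H} (hM : ∀ n : Fin N, (M n).HasKraus (if (n : ℕ) = 0 then K else L))
    (hLK : ∀ ω, L ω * K ω = K ω) (ω : Ω) (T : TraceClass H) :
    (consecutive N M (fun _ => ω) T : H →L[ℂ] H) = K ω * (T : H →L[ℂ] H) * star (K ω) := by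
  induction N, hN using Nat.le_induction with
  | base => exact hM 0 ω T
  | succ N hN ih =>
    refine (hM (Fin.last N) ω _).trans ?_
    rw [ih (M := fun n => M n.castSucc) fun n => hM n.castSucc, Fin.val_last,
      if_neg (by omega : N ≠ 0)]
    have h : star (K ω) * star (L ω) = star (K ω) := by rw [← star_mul, hLK]
    rw [mul_assoc, mul_assoc, h, ← mul_assoc, ← mul_assoc, hLK]

end Protocols

/-! ### The Helstrom bound and its attainment -/

section Helstrom

variable {H : Type*} [NormedAddCommGroup H] [InnerProductSpace ℂ H] [CompleteSpace H]
variable (ρ : Fin 2 → DensityOperator H) (q : Fin 2 → ℝ)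

/-- `q₁ρ₁ - q₂ρ₂` as an element of the trace class. -/
def helstromTraceClass : TraceClass H := (q 0 : ℂ) • (ρ 0).op - (q 1 : ℂ) • (ρ 1).op

lemma coe_helstromTraceClass : (helstromTraceClass ρ q : H →L[ℂ] H) = helstromOp ρ q := rfl

/-- `|q₁ρ₁ - q₂ρ₂|` as an element of the trace class. -/
def absHelstrom : TraceClass H := ⟨_, abs_mem_traceClass (helstromTraceClass ρ q).2⟩

lemma isSelfAdjoint_helstromOp : IsSelfAdjoint (helstromOp ρ q) := by
  have h (j : Fin 2) : star ((ρ j).op : H →L[ℂ] H) = (ρ j).op :=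
    (IsSelfAdjoint.of_nonneg (ρ j).pos).star_eq
  change star (helstromOp ρ q) = _
  simp only [helstromOp, star_sub, star_smul, h, Complex.star_def, Complex.conj_ofReal]

lemma apply_helstromTraceClass_re (f : TraceClass H →ₗ[ℂ] ℂ) :
    (f (helstromTraceClass ρ q)).re = q 0 * (f (ρ 0).op).re - q 1 * (f (ρ 1).op).re := by
  rw [helstromTraceClass, map_sub, map_smul, map_smul, Complex.sub_re, smul_eq_mul, smul_eq_mul,
    Complex.re_ofReal_mul, Complex.re_ofReal_mul]

lemma opTrace_helstromOp_re : (opTrace (helstromOp ρ q)).re = q 0 - q 1 := by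
  have h := apply_helstromTraceClass_re ρ q (traceLinear H)
  simpa [traceLinear_apply, coe_helstromTraceClass, DensityOperator.trace_eq_one] using h

lemma trace_absHelstrom_re :
    (traceLinear H (absHelstrom ρ q)).re = (traceNorm (helstromOp ρ q)).toReal :=
  (toReal_traceNorm (helstromTraceClass ρ q).2).symm

variable {q} {N : ℕ}

/-- The Helstrom bound holds for sequential protocols. -/
lemma successProb_le_helstromBound (hq : ∀ j, 0 < q j) (hq1 : ∑ j, q j = 1) (hN : 1 ≤ N)
    (M : Fin N → StateInstrument H (Fin 2)) : successProb ρ q M ≤ helstromBound ρ q := by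
  have hsum := sum_trace_re_consecutive_le hN M (ρ 1).pos
  rw [(ρ 1).trace_eq_one, Complex.one_re, Fin.sum_univ_two] at hsum
  set f : TraceClass H →ₗ[ℂ] ℂ := traceLinear H ∘ₗ consecutive N M (fun _ => 0) with hf
  have hX := apply_helstromTraceClass_re ρ q f
  have htr := opTrace_helstromOp_re ρ q
  have hsa := isSelfAdjoint_helstromOp ρ q
  set X := helstromTraceClass ρ q with hXdef
  set A := absHelstrom ρ q with hA
  have hpos : 0 ≤ ((A + X : TraceClass H) : H →L[ℂ] H) := by
    change 0 ≤ CFC.abs (helstromOp ρ q) + helstromOp ρ q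
    rw [CFC.abs_add_self _ hsa]
    exact nsmul_nonneg (CFC.posPart_nonneg _) 2
  have hneg : 0 ≤ ((A - X : TraceClass H) : H →L[ℂ] H) := by
    change 0 ≤ CFC.abs (helstromOp ρ q) - helstromOp ρ q
    rw [CFC.abs_sub_self _ hsa]
    exact nsmul_nonneg (CFC.negPart_nonneg _) 2
  -- Adding `f X ≤ f A` to `f (A + X) ≤ tr (A + X)` eliminates `f A` and bounds `2 f X`.
  have h1 : 0 ≤ (f (A - X)).re := opTrace_nonneg (consecutive_nonneg M _ hneg)
  have h2 : (f (A + X)).re ≤ (traceLinear H (A + X)).re := by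
    have h := sum_trace_re_consecutive_le hN M hpos
    rw [Fin.sum_univ_two] at h
    have h0 := opTrace_nonneg (consecutive_nonneg M (fun _ => 1) hpos)
    exact (le_add_of_nonneg_right h0).trans h
  rw [map_add, map_add, Complex.add_re, Complex.add_re, hA, trace_absHelstrom_re, ← hA] at h2
  rw [map_sub, Complex.sub_re] at h1
  change _ ≤ _ + (opTrace (helstromOp ρ q)).re at h2
  rw [Fin.sum_univ_two] at hq1
  rw [successProb, Fin.sum_univ_two, helstromBound]
  change q 0 * (f (ρ 0).op).re + _ ≤ _
  change (f (ρ 1).op).re + _ ≤ 1 at hsum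
  -- This trades the success term of `ρ 1` for `q 1 - q 1 * f (ρ 1)`, which combines with the term
  -- of `ρ 0` to `q 1 + f X`.
  have h3 := mul_le_mul_of_nonneg_left hsum (hq 1).le
  linarith

lemma star_helstromProj_mul_self (q : Fin 2 → ℝ) (j : Fin 2) :
    star (helstromProj ρ q j) * helstromProj ρ q j = helstromProj ρ q j := by
  have h := isStarProjection_starProjection (U := positiveSubspace (helstromOp ρ q))
  have h' : IsStarProjection (helstromProj ρ q j) := by
    fin_cases j
    · exact h
    · exact h.one_sub
  rw [h'.isSelfAdjoint.star_eq, h'.isIdempotentElem]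

lemma sum_helstromProj (q : Fin 2 → ℝ) : ∑ j, helstromProj ρ q j = 1 := by
  rw [Fin.sum_univ_two]
  exact add_sub_cancel _ _

/-- Any pure measurement whose effects are the Helstrom projections attains the Helstrom bound. -/
lemma sum_opTrace_kraus_eq_helstromBound (hq1 : ∑ j, q j = 1) {K : Fin 2 → H →L[ℂ] H}
    (hK : ∀ j, star (K j) * K j = helstromProj ρ q j) :
    ∑ j, q j * (opTrace (K j * ((ρ j).op : H →L[ℂ] H) * star (K j))).re = helstromBound ρ q := by
  have hPP := star_helstromProj_mul_self ρ q
  have hsum : ∑ j, star (K j) * K j = 1 := by simp_rw [hK, sum_helstromProj]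
  have hn := norm_le_one_of_sum_star_mul_self hsum
  have h1 := congrArg Complex.re (sum_opTrace_conj hsum (ρ 1).op)
  rw [(ρ 1).trace_eq_one, Fin.sum_univ_two, Complex.add_re, Complex.one_re] at h1
  have h2 := apply_helstromTraceClass_re ρ q (traceLinear H ∘ₗ conjMap (K 0) (hn 0))
  have hP0 : ‖helstromProj ρ q 0‖ ≤ 1 := norm_le_one_of_sum_star_mul_self
    (K := helstromProj ρ q) (by simp_rw [hPP, sum_helstromProj]) 0
  -- Having the same effect, `K 0` may be replaced by the projection itself, to which the
  -- compression identity applies.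
  have h3 : traceLinear H ∘ₗ conjMap (K 0) (hn 0) =
      traceLinear H ∘ₗ conjMap (helstromProj ρ q 0) hP0 :=
    linearMap_ext_nonneg fun T h0 => opTrace_conj_congr h0 ((hK 0).trans (hPP 0).symm)
  have h4 : (2 : ℂ) • conjMap (helstromProj ρ q 0) hP0 (helstromTraceClass ρ q) =
      absHelstrom ρ q + helstromTraceClass ρ q := by
    ext1
    have hst : star (helstromProj ρ q 0) = helstromProj ρ q 0 :=
      isStarProjection_starProjection.isSelfAdjoint.star_eq
    rw [Submodule.coe_smul, coe_conjMap, hst]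
    exact two_smul_positive_compression (isSelfAdjoint_helstromOp ρ q) (helstromTraceClass ρ q).2
  have h5 := congrArg (fun T => (traceLinear H T).re) h4
  simp only [map_smul, map_add, Complex.add_re, trace_absHelstrom_re, smul_eq_mul,
    Complex.mul_re, Complex.re_ofNat, Complex.im_ofNat, zero_mul, sub_zero] at h5
  rw [h3, LinearMap.comp_apply, ← h3] at h2
  have h6 : (traceLinear H (helstromTraceClass ρ q)).re = q 0 - q 1 := opTrace_helstromOp_re ρ q
  simp only [LinearMap.comp_apply, traceLinear_apply, coe_conjMap] at h2 h5 h6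
  rw [Fin.sum_univ_two] at hq1
  rw [Fin.sum_univ_two, helstromBound]
  have h7 := congrArg (q 1 * ·) h1
  linarith

/-- A sequential protocol with pure instruments attains the Helstrom bound when the first receiver
measures the Helstrom projections and the others leave the posterior states unchanged. -/
lemma exists_successProb_eq_helstromBound (hq1 : ∑ j, q j = 1) (hN : 1 ≤ N)
    {K L : Fin 2 → H →L[ℂ] H} (hK : ∀ j, star (K j) * K j = helstromProj ρ q j)
    (hL : ∑ j, star (L j) * L j = 1) (hLK : ∀ j, L j * K j = K j) :
    ∃ M : Fin N → StateInstrument H (Fin 2),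
      (∀ n : Fin N, (M n).HasKraus (if (n : ℕ) = 0 then K else L)) ∧
      successProb ρ q M = helstromBound ρ q := by
  have hKsum : ∑ j, star (K j) * K j = 1 := by simp_rw [hK, sum_helstromProj]
  have hM (n : Fin N) : (if (n : ℕ) = 0 then krausInstrument K hKsum
      else krausInstrument L hL).HasKraus (if (n : ℕ) = 0 then K else L) := by
    split_ifs <;> exact krausInstrument_hasKraus _ _
  refine ⟨_, hM, ?_⟩
  rw [← sum_opTrace_kraus_eq_helstromBound ρ hq1 hK, successProb]
  exact Finset.sum_congr rfl fun j _ => by rw [consecutive_hasKraus hN hM hLK]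

end Helstrom

end SeqDisc

end

/-! ### The main theorem -/

theorem theorem2 {H : Type*} [NormedAddCommGroup H] [InnerProductSpace ℂ H] [CompleteSpace H]
    (ρ : Fin 2 → SeqDisc.DensityOperator H) (q : Fin 2 → ℝ)
    (hq : ∀ j, 0 < q j) (hq1 : ∑ j, q j = 1) (N : ℕ) (hN : 1 ≤ N) :
    -- the optimal success probability is the Helstrom bound
    SeqDisc.IsOptimalSuccessProb N ρ q (SeqDisc.helstromBound ρ q) ∧
    -- it is attained when every receiver applies the instrument `P₀(j) [·] P₀(j)`
    (∃ M : Fin N → SeqDisc.StateInstrument H (Fin 2),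
      (∀ n, (M n).HasKraus (SeqDisc.helstromProj ρ q)) ∧
      SeqDisc.successProb ρ q M = SeqDisc.helstromBound ρ q) ∧
    -- it is attained when the first receiver applies `K(j) [·] K(j)†`, the others `P(j) [·] P(j)`,
    -- with `K(j) = ∑ᵢ |φᵢ(j)⟩⟨vᵢ(j)|`, `P(j) = ∑ᵢ |φᵢ(j)⟩⟨φᵢ(j)|`, `P₀(j) = ∑ᵢ |vᵢ(j)⟩⟨vᵢ(j)|`
    ((∀ j, SeqDisc.helstromProj ρ q j ≠ 0) →
      ∀ (ι : Fin 2 → Type*) (v : (Σ j, ι j) → H) (hv : Orthonormal ℂ v)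
        (φ : HilbertBasis (Σ j, ι j) ℂ H),
        (∀ j, SeqDisc.blockKetBra hv hv j = SeqDisc.helstromProj ρ q j) →
        ∃ M : Fin N → SeqDisc.StateInstrument H (Fin 2),
          (∀ n : Fin N, (M n).HasKraus
            (if (n : ℕ) = 0 then SeqDisc.blockKetBra φ.orthonormal hv
              else SeqDisc.blockKetBra φ.orthonormal φ.orthonormal)) ∧
          SeqDisc.successProb ρ q M = SeqDisc.helstromBound ρ q) := by
  have hPP := SeqDisc.star_helstromProj_mul_self ρ q
  have hP : ∑ j, star (SeqDisc.helstromProj ρ q j) * SeqDisc.helstromProj ρ q j = 1 := by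
    simp_rw [hPP, SeqDisc.sum_helstromProj]
  have hid (j : Fin 2) :
      SeqDisc.helstromProj ρ q j * SeqDisc.helstromProj ρ q j = SeqDisc.helstromProj ρ q j := by
    have h : star (SeqDisc.helstromProj ρ q j) = SeqDisc.helstromProj ρ q j := by
      rw [← hPP j, star_mul, star_star]
    have h2 := hPP j
    rwa [h] at h2
  -- Taking `K = L = P₀` is allowed since `P₀(j)` is a self-adjoint idempotent.
  obtain ⟨M, hM, hMs⟩ := SeqDisc.exists_successProb_eq_helstromBound ρ hq1 hN hPP hP hid
  refine ⟨⟨⟨M, hMs⟩, ?_⟩, ⟨M, fun n => by simpa using hM n, hMs⟩, ?_⟩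
  · rintro _ ⟨M', rfl⟩
    exact SeqDisc.successProb_le_helstromBound ρ hq hq1 hN M'
  · intro _ ι v hv φ hvP
    -- Here `K̃† K̃ = ∑ᵢ |vᵢ⟩⟨vᵢ| = P₀` and `P̃ K̃ = K̃` in each block; completeness of `φ` makes
    -- the `P̃(j)` sum to the identity.
    refine SeqDisc.exists_successProb_eq_helstromBound ρ hq1 hN (fun j => ?_) ?_ fun j =>
      SeqDisc.ketBra_mul_ketBra _ _ _
    · rw [← hvP j, SeqDisc.blockKetBra, SeqDisc.star_ketBra, SeqDisc.ketBra_mul_ketBra]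
      rfl
    · rw [← SeqDisc.sum_blockKetBra φ]
      refine Finset.sum_congr rfl fun j _ => ?_
      rw [SeqDisc.blockKetBra, SeqDisc.star_ketBra, SeqDisc.ketBra_mul_ketBra]
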